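/- Let $G$ be a finite group with a supercharacter theory $S$, that is, a pair consisting of a partition $\mathcal X$ of the set $\mathrm{Irr}(G)$ of complex irreducible characters of $G$ and a partition $\mathcal Y$ of $G$ with $\{1\}\in\mathcal Y$ and $|\mathcal X|=|\mathcal Y|$, such that for each $X\in\mathcal X$ the character $\sigma_X=\sum_{\chi\in X}\chi(1)\chi$ is constant on each $Y\in\mathcal Y$. The $\sigma_X$ are the supercharacters and the $Y$ are the superclasses; $\mathrm{Cl}_S(g)$ denotes the superclass containing $g$. Let $[G,S]=\langle g^{-1}k : g\in G,\ k\in \mathrm{Cl}_S(g)\rangle$, and let $V(S)$ be the subgroup generated by all $g\in G$ such that $\sigma(g)\neq 0$ for some supercharacter $\sigma$ whose kernel $\{x\in G:\sigma(x)=\sigma(1)\}$ does not contain $[G,S]$. A subgroup $N\le G$ is $S$-normal if it is a union of superclasses. In that case the images in $G/N$ of the superclasses of $S$ are the superclasses of a supercharacter theory $S^{G/N}$ of $G/N$, and $Z(S^{G/N})$ denotes the subgroup of those elements of $G/N$ whose superclass has exactly one element. The upper $S$-central series is defined by $\zeta_0(S)=1$ and $\zeta_i(S)/\zeta_{i-1}(S)=Z(S^{G/\zeta_{i-1}(S)})$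 for $i\ge 1$. The group $G$ is $S$-nilpotent if there is a series $G=N_1\ge N_2\ge\cdots\ge N_{r+1}=1$ of $S$-normal subgroups with $N_i/N_{i+1}\le Z(S^{G/N_{i+1}})$ for $1\le i\le r$. Then the following hold. 1. For every integer $m\ge 0$, if $[G,S]\nleq \zeta_m(S)$, then $\zeta_{m+1}(S)\le V(S)$. 2. If $G$ is $S$-nilpotent, then there is a least positive integer $c$ with $\zeta_c(S)=G$ (the $S$-nilpotence class of $G$), and $\zeta_{c-1}(S)\le V(S)$. 3. If $G$ is not $S$-nilpotent, then there is a positive integer $n$ with $\zeta_m(S)=\zeta_n(S)$ for all $m\ge n$, and the $S$-hypercenter $\zeta_\infty(S)=\zeta_n(S)$ satisfies $\zeta_\infty(S)\le V(S)$. -/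

import Mathlib

/-- `Irr(G)`: the set of complex irreducible characters of `G`, as functions `G → ℂ`. -/
def IrrChar (G : Type*) [Group G] : Set (G → ℂ) :=
  {χ | ∃ (n : ℕ) (ρ : Representation ℂ G (Fin n → ℂ)), ρ.IsIrreducible ∧ χ = ρ.character}

/-- A finite group has only finitely many irreducible characters, by orthonormality. -/
instance IrrChar.instFinite (G : Type*) [Group G] [Finite G] : Finite (IrrChar G) := by
  classical
  have := Fintype.ofFinite G
  have hne : (Nat.card G : ℂ) ≠ 0 := Nat.cast_ne_zero.2 Nat.card_pos.ne'
  let : Invertible (Nat.card G : ℂ) := invertibleOfNonzero hne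
  have hpair : ∀ χ ψ : IrrChar G,
      (Nat.card G : ℂ)⁻¹ * ∑ g : G, χ.1 g * ψ.1 g⁻¹ = if χ = ψ then 1 else 0 := by
    rintro ⟨χ, n, ρ, hρ, rfl⟩ ⟨ψ, m, σ, hσ, rfl⟩
    have := hρ
    have := hσ
    have h := Representation.char_orthonormal ρ σ
    have h1 := Representation.char_orthonormal ρ ρ
    rw [if_pos ⟨Representation.Equiv.refl ρ⟩] at h1
    by_cases e : ρ.character = σ.character
    · simp only [e] at h1 ⊢
      rw [if_pos trivial]
      exact h1
    · rw [if_neg (fun ⟨f⟩ => e (Representation.char_iso f).symm)] at h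
      rw [if_neg (fun he => e (congrArg Subtype.val he))]
      exact h
  have hli : LinearIndependent ℂ (fun χ : IrrChar G => χ.1) := by
    rw [linearIndependent_iff']
    intro s c hc ψ hψ
    have h0 : (Nat.card G : ℂ)⁻¹ * ∑ g : G, (∑ χ ∈ s, c χ • χ.1) g * ψ.1 g⁻¹ = 0 := by
      rw [hc]
      simp
    have h2 : (Nat.card G : ℂ)⁻¹ * ∑ g : G, (∑ χ ∈ s, c χ • χ.1) g * ψ.1 g⁻¹
        = ∑ χ ∈ s, c χ * ((Nat.card G : ℂ)⁻¹ * ∑ g : G, χ.1 g * ψ.1 g⁻¹) := by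
      simp only [Finset.sum_apply, Pi.smul_apply, smul_eq_mul, Finset.sum_mul, Finset.mul_sum]
      rw [Finset.sum_comm]
      refine Finset.sum_congr rfl fun χ _ => Finset.sum_congr rfl fun g _ => by ring
    rw [h2] at h0
    simp only [hpair] at h0
    simpa [hψ] using h0
  exact hli.finite

/-- For a set `X` of irreducible characters, `σ_X = ∑_{χ ∈ X} χ(1) χ`. -/
noncomputable def sigmaChar {G : Type*} [Group G] [Finite G] (X : Set (IrrChar G)) : G → ℂ :=
  fun g => ∑ χ ∈ (Set.toFinite X).toFinset, χ.1 1 * χ.1 g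

/-- The part of the family `P` that contains `a` (when `P` is a partition). -/
def partOf {α : Type*} (P : Set (Set α)) (a : α) : Set α :=
  ⋃₀ {K | K ∈ P ∧ a ∈ K}

/-- A supercharacter theory of the finite group `G`. -/
structure SupercharacterTheory (G : Type*) [Group G] [Finite G] where
  /-- the partition of `Irr(G)` -/
  charParts : Set (Set (IrrChar G))
  /-- the partition of `G`, whose parts are the superclasses: `Cl(S)` -/
  classes : Set (Set G)
  charParts_isPartition : Setoid.IsPartition charParts
  classes_isPartition : Setoid.IsPartition classes
  singleton_one_mem : {1} ∈ classes
  ncard_eq : charParts.ncard = classes.ncard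
  sigma_const : ∀ X ∈ charParts, ∀ K ∈ classes, ∀ g ∈ K, ∀ h ∈ K,
    sigmaChar X g = sigmaChar X h

namespace SupercharacterTheory

variable {G : Type*} [Group G] [Finite G]

/-- `Irr(S)`: the supercharacters of `S`. -/
def superchars (S : SupercharacterTheory G) : Set (G → ℂ) :=
  {σ | ∃ X ∈ S.charParts, σ = sigmaChar X}

/-- `Irr(S ∣ N)`: the supercharacters of `S` whose kernel `{g | σ g = σ 1}` does not
contain `N`. -/
def supercharsOver (S : SupercharacterTheory G) (N : Subgroup G) : Set (G → ℂ) :=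
  {σ | σ ∈ S.superchars ∧ ¬ (N : Set G) ⊆ {g | σ g = σ 1}}

/-- `Cl_S(g)`: the superclass of `g`. -/
def superclass (S : SupercharacterTheory G) (g : G) : Set G :=
  partOf S.classes g

/-- `[H, S]`, the subgroup generated by the elements `g⁻¹ k` with `g ∈ H` and `k ∈ Cl_S(g)`. -/
def comm (S : SupercharacterTheory G) (H : Subgroup G) : Subgroup G :=
  Subgroup.closure {x | ∃ g ∈ H, ∃ k ∈ S.superclass g, x = g⁻¹ * k}

/-- `V(S ∣ N)`, the subgroup generated by the elements of `G` at which some member of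
`Irr(S ∣ N)` does not vanish. -/
def vanishingOffOver (S : SupercharacterTheory G) (N : Subgroup G) : Subgroup G :=
  Subgroup.closure {g | ∃ σ ∈ S.supercharsOver N, σ g ≠ 0}

/-- `V(S) = V(S ∣ [G, S])`. -/
def vanishingOff (S : SupercharacterTheory G) : Subgroup G :=
  S.vanishingOffOver (S.comm ⊤)

/-- `N` is `S`-normal: it is a union of superclasses. -/
def IsSNormal (S : SupercharacterTheory G) (N : Subgroup G) : Prop :=
  ∃ C : Set (Set G), C ⊆ S.classes ∧ (N : Set G) = ⋃₀ C

/-- `Cl(S^{G/N}) = {π(K) : K ∈ Cl(S)}`: the superclasses of the deflation of `S` to `G ⧸ N`.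
It is used for `S`-normal `N`; these are normal in `G`, and `G ⧸ N` is then the quotient group. -/
def deflationClasses (S : SupercharacterTheory G) (N : Subgroup G) : Set (Set (G ⧸ N)) :=
  {L | ∃ K ∈ S.classes, L = (QuotientGroup.mk : G → G ⧸ N) '' K}

/-- `Z(S^{G/N})`: the elements of `G ⧸ N` whose superclass under the deflation of `S` has exactly
one element. -/
def deflationCenter (S : SupercharacterTheory G) (N : Subgroup G) : Set (G ⧸ N) :=
  {x | (partOf (S.deflationClasses N) x).ncard = 1}

/-- The upper `S`-central series: `ζ_0(S) = 1`, and `ζ_{i+1}(S)` is the preimage in `G` of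
`Z(S^{G/ζ_i(S)})`. For an `S`-normal `N` the center `Z(S^{G/N})` is a subgroup of `G ⧸ N`, so its
preimage is a subgroup of `G`; `Subgroup.closure` only turns that set into a term of type
`Subgroup G`. -/
def zeta (S : SupercharacterTheory G) : ℕ → Subgroup G
  | 0 => ⊥
  | i + 1 => Subgroup.closure
      ((QuotientGroup.mk : G → G ⧸ S.zeta i) ⁻¹' S.deflationCenter (S.zeta i))

/-- `G` is `S`-nilpotent: there is a series `G = N 0 ≥ N 1 ≥ ⋯ ≥ N r = 1` of `S`-normal subgroups
with `N i / N (i + 1) ≤ Z(S^{G / N (i + 1)})` for all `i < r`. -/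
def IsSNilpotent (S : SupercharacterTheory G) : Prop :=
  ∃ (r : ℕ) (N : ℕ → Subgroup G), N 0 = ⊤ ∧ N r = ⊥ ∧ (∀ i ≤ r, S.IsSNormal (N i)) ∧
    ∀ i < r, N (i + 1) ≤ N i ∧
      (QuotientGroup.mk : G → G ⧸ N (i + 1)) '' (N i : Set G) ⊆ S.deflationCenter (N (i + 1))

/-- `c` is the `S`-nilpotence class of `G`: the least positive integer with `ζ_c(S) = G`. -/
def IsSNilpotenceClass (S : SupercharacterTheory G) (c : ℕ) : Prop :=
  IsLeast {k : ℕ | 0 < k ∧ S.zeta k = ⊤} c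

/-- `H` is the `S`-hypercenter `ζ_∞(S)`: the subgroup at which the upper `S`-central series
becomes stationary. -/
def IsSHypercenter (S : SupercharacterTheory G) (H : Subgroup G) : Prop :=
  ∃ n : ℕ, 0 < n ∧ S.zeta n = H ∧ ∀ m ≥ n, S.zeta m = S.zeta n

end SupercharacterTheory

/-!
The supercharacters `σ_X` are orthogonal, hence linearly independent, and there are as many of them
as superclasses, so they span the functions constant on superclasses (`exists_eq_sum_sigmaChar`).
Three consequences carry the argument.

* Superclasses are invariant under conjugation, so `S`-normal subgroups are normal.
* For an `S`-normal `N`, the indicator function of `N` is a combination of supercharacters. By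
  orthogonality and Schur's lemma, only those with `N` in their kernel occur, and hence these cut
  out `N` (`IsSNormal.mem_of_forall_sigmaChar_eq`).
* If the superclass of `g` lies in `gN`, then `g` acts by a scalar in every irreducible
  representation trivial on `N`. Expanding the indicator function of this superclass shows that the
  scalar is the same for all `χ ∈ X`, so that `σ_X(gy) = c σ_X(y)` for all `y`
  (`exists_sigmaChar_mul_eq`).

Conversely, by the second point, if `g` multiplies by a scalar every `σ_X` whose members are
trivial on `N`, then its superclass lies in `gN`. This describes the preimage of `Z(S^{G/N})` as
the set `centerMod N` of elements acting by such scalars, which is visibly a subgroup, monotone in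
`N`, and a union of superclasses. In particular all `ζ_i(S)` are `S`-normal, and
`ζ_{i+1}(S)` is `centerMod (ζ_i(S))`.

If `[G, S]` is not contained in the `S`-normal `N`, then the second point gives a supercharacter
`σ_X` whose members are trivial on `N` and whose kernel does not contain `[G, S]`. On `centerMod N`
its values are nonzero multiples of `σ_X(1) ≠ 0`, so `centerMod N ≤ V(S)`. With `N = ζ_m(S)` this
is the first assertion. If `[G, S] ≤ ζ_m(S)`, then the superclass of every `g` lies in `g ζ_m(S)` and
`ζ_{m+1}(S) = G`; this, together with the comparison of an arbitrary `S`-central series with the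
upper one, gives the other two.
-/

/-! ### Irreducible characters -/

section Irreducible

variable {G : Type*} [Group G]

/-- Schur's lemma for a single endomorphism commuting with an irreducible representation. -/
theorem Representation.IsIrreducible.exists_eq_smul_one_of_commute {n : ℕ}
    {ρ : Representation ℂ G (Fin n → ℂ)} (hρ : ρ.IsIrreducible)
    {T : Module.End ℂ (Fin n → ℂ)} (hT : ∀ g, T * ρ g = ρ g * T) :
    ∃ c : ℂ, T = c • (1 : Module.End ℂ (Fin n → ℂ)) := by
  have := hρ
  let f : Representation.IntertwiningMap ρ ρ := ⟨T, hT⟩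
  obtain ⟨c, hc⟩ :=
    (Representation.IsIrreducible.algebraMap_intertwiningMap_bijective_of_isAlgClosed
      (ρ := ρ)).2 f
  refine ⟨c, LinearMap.ext fun v => ?_⟩
  have h := congrArg (fun F : Representation.IntertwiningMap ρ ρ => F v) hc
  simpa [f] using h.symm

theorem Representation.IsIrreducible.character_one_ne_zero {n : ℕ}
    {ρ : Representation ℂ G (Fin n → ℂ)} (hρ : ρ.IsIrreducible) : ρ.character 1 ≠ 0 := by
  rw [Representation.char_one, Module.finrank_fin_fun, Nat.cast_ne_zero]
  rintro rfl
  obtain ⟨a, b, hab⟩ := hρ.toNontrivial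
  exact hab (SetLike.ext fun x => by
    rw [Subsingleton.elim x 0]
    exact iff_of_true (Submodule.zero_mem a.toSubmodule) (Submodule.zero_mem b.toSubmodule))

namespace IrrChar

theorem apply_one_ne_zero (χ : IrrChar G) : χ.1 1 ≠ 0 := by
  obtain ⟨χ, n, ρ, hρ, rfl⟩ := χ
  exact hρ.character_one_ne_zero

theorem apply_conj (χ : IrrChar G) (g h : G) : χ.1 (h * g * h⁻¹) = χ.1 g := by
  obtain ⟨χ, n, ρ, hρ, rfl⟩ := χ
  exact ρ.char_conj g h

/-- `χ` is afforded by an irreducible representation that is trivial on `N`, that is, the kernel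
of `χ` contains `N`. -/
def TrivialOn (χ : IrrChar G) (N : Subgroup G) : Prop :=
  ∃ (n : ℕ) (ρ : Representation ℂ G (Fin n → ℂ)), ρ.IsIrreducible ∧ χ.1 = ρ.character ∧
    ∀ x ∈ N, ρ x = 1

theorem TrivialOn.mono {χ : IrrChar G} {M N : Subgroup G} (hMN : M ≤ N) (h : TrivialOn χ N) :
    TrivialOn χ M := by
  obtain ⟨n, ρ, hρ, hχ, hN⟩ := h
  exact ⟨n, ρ, hρ, hχ, fun x hx => hN x (hMN hx)⟩

theorem TrivialOn.apply_mul_left {χ : IrrChar G} {N : Subgroup G} (h : TrivialOn χ N) {x : G}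
    (hx : x ∈ N) (y : G) : χ.1 (x * y) = χ.1 y := by
  obtain ⟨n, ρ, hρ, hχ, hN⟩ := h
  rw [hχ, Representation.character, Representation.character, map_mul, hN x hx, one_mul]

/-- An element that is central modulo `N` acts by a scalar in every irreducible representation
trivial on `N`. -/
theorem TrivialOn.exists_apply_mul_eq {χ : IrrChar G} {N : Subgroup G} (h : TrivialOn χ N) {g : G}
    (hg : ∀ x, (x * g)⁻¹ * (g * x) ∈ N) : ∃ c : ℂ, ∀ y, χ.1 (g * y) = c * χ.1 y := by
  obtain ⟨n, ρ, hρ, hχ, hN⟩ := h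
  obtain ⟨c, hc⟩ := hρ.exists_eq_smul_one_of_commute (T := ρ g) fun x => by
    have := hN _ (hg x)
    rw [← map_mul, ← map_mul]
    calc ρ (g * x) = ρ (x * g * ((x * g)⁻¹ * (g * x))) := by rw [mul_inv_cancel_left]
      _ = ρ (x * g) := by rw [map_mul ρ (x * g), this, mul_one]
  refine ⟨c, fun y => ?_⟩
  rw [hχ, Representation.character, Representation.character, map_mul, hc, smul_one_mul, map_smul,
    smul_eq_mul]

variable [Finite G]

/-- The character `χ` occurs in the permutation character on `G ⧸ N` only if its kernel
contains `N`. -/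
theorem trivialOn_of_finsum_ne_zero (χ : IrrChar G) (N : Subgroup G) [N.Normal]
    (h : ∑ᶠ x : N, χ.1 (x : G)⁻¹ ≠ 0) : TrivialOn χ N := by
  classical
  have := Fintype.ofFinite N
  rw [finsum_eq_sum_of_fintype] at h
  obtain ⟨χ, n, ρ, hρ, rfl⟩ := χ
  refine ⟨n, ρ, hρ, rfl, ?_⟩
  -- The sum of the operators of `N` commutes with `G`, so it is a scalar, and `N` fixes it.
  let T : Module.End ℂ (Fin n → ℂ) := ∑ x : N, ρ (x : G)⁻¹
  have hT : ∀ g, T * ρ g = ρ g * T := by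
    intro g
    simp only [T, Finset.sum_mul, Finset.mul_sum]
    refine Fintype.sum_equiv (MulAut.conjNormal g⁻¹).toEquiv _ _ fun x => ?_
    rw [← map_mul, ← map_mul]
    congr 1
    simp [mul_assoc]
  obtain ⟨c, hc⟩ := hρ.exists_eq_smul_one_of_commute hT
  have hc0 : c ≠ 0 := by
    rintro rfl
    apply h
    have := congrArg (LinearMap.trace ℂ (Fin n → ℂ)) hc
    simpa [T, Representation.character] using this
  intro y hy
  have hyT : ρ y * T = T := by
    simp only [T, Finset.mul_sum]
    refine Fintype.sum_equiv (Equiv.mulRight (⟨y, hy⟩ : N)⁻¹) _ _ fun x => ?_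
    rw [← map_mul]
    congr 1
    simp
  rw [hc, mul_smul_comm, mul_one] at hyT
  exact smul_right_injective _ hc0 hyT

end IrrChar

/-! ### The pairing of a function with an irreducible character -/

variable [Finite G]

/-- The pairing `|G|⁻¹ ∑_g f(g) χ(g⁻¹)` of a function with an irreducible character; this is the
usual inner product `⟨f, χ⟩`. -/
noncomputable def charPairing (χ : IrrChar G) : (G → ℂ) →ₗ[ℂ] ℂ where
  toFun f := (Nat.card G : ℂ)⁻¹ * ∑ᶠ g : G, f g * χ.1 g⁻¹
  map_add' f₁ f₂ := by
    have := Fintype.ofFinite G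
    simp only [finsum_eq_sum_of_fintype, Pi.add_apply, add_mul, Finset.sum_add_distrib, mul_add]
  map_smul' c f := by
    have := Fintype.ofFinite G
    simp only [finsum_eq_sum_of_fintype, Pi.smul_apply, smul_eq_mul, mul_assoc, ← Finset.mul_sum,
      RingHom.id_apply]
    ring

theorem charPairing_apply [Fintype G] (χ : IrrChar G) (f : G → ℂ) :
    charPairing χ f = (Nat.card G : ℂ)⁻¹ * ∑ g : G, f g * χ.1 g⁻¹ := by
  simp [charPairing, finsum_eq_sum_of_fintype]

open Classical in
theorem charPairing_irrChar (χ ψ : IrrChar G) :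
    charPairing χ ψ.1 = if ψ = χ then 1 else 0 := by
  have := Fintype.ofFinite G
  let : Invertible (Nat.card G : ℂ) :=
    invertibleOfNonzero (Nat.cast_ne_zero.2 Nat.card_pos.ne')
  obtain ⟨χ, n, ρ, hρ, rfl⟩ := χ
  obtain ⟨ψ, m, σ, hσ, rfl⟩ := ψ
  rw [charPairing_apply]
  have := hρ
  have := hσ
  split_ifs with e
  · have e' : σ.character = ρ.character := congrArg Subtype.val e
    have h := Representation.char_orthonormal ρ ρ
    rw [if_pos ⟨Representation.Equiv.refl ρ⟩] at h
    simpa only [e'] using h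
  · have h := Representation.char_orthonormal σ ρ
    rwa [if_neg fun ⟨f⟩ => e (Subtype.ext (Representation.char_iso f).symm)] at h

theorem sigmaChar_eq_sum (X : Set (IrrChar G)) :
    sigmaChar X = ∑ ψ ∈ (Set.toFinite X).toFinset, ψ.1 1 • ψ.1 := by
  ext g
  simp [sigmaChar, Finset.sum_apply]

open Classical in
theorem charPairing_sigmaChar (χ : IrrChar G) (X : Set (IrrChar G)) :
    charPairing χ (sigmaChar X) = if χ ∈ X then χ.1 1 else 0 := by
  rw [sigmaChar_eq_sum, map_sum]
  simp [charPairing_irrChar]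

/-- The degree `σ_X(1) = ∑ χ(1)²` is nonzero. -/
theorem sigmaChar_one_ne_zero {X : Set (IrrChar G)} (hX : X.Nonempty) : sigmaChar X 1 ≠ 0 := by
  have h : ∀ χ : IrrChar G, ∃ d : ℕ, d ≠ 0 ∧ χ.1 1 = d := by
    rintro ⟨χ, n, ρ, hρ, rfl⟩
    have := hρ.character_one_ne_zero
    rw [Representation.char_one, Nat.cast_ne_zero] at this
    exact ⟨_, this, ρ.char_one⟩
  choose d hd0 hd using h
  have : sigmaChar X 1 = ((∑ χ ∈ (Set.toFinite X).toFinset, d χ * d χ : ℕ) : ℂ) := by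
    simp [sigmaChar, hd]
  obtain ⟨χ, hχ⟩ := hX
  rw [this, Nat.cast_ne_zero, ← Nat.pos_iff_ne_zero]
  exact Finset.sum_pos (fun ψ _ => Nat.pos_of_ne_zero (mul_ne_zero (hd0 ψ) (hd0 ψ)))
    ⟨χ, by simpa using hχ⟩

theorem sigmaChar_conj (X : Set (IrrChar G)) (g h : G) :
    sigmaChar X (h * g * h⁻¹) = sigmaChar X g := by
  simp only [sigmaChar, IrrChar.apply_conj]

theorem sigmaChar_mul_left_eq {X : Set (IrrChar G)} {g : G} {c : ℂ}
    (h : ∀ χ ∈ X, ∀ y, χ.1 (g * y) = c * χ.1 y) (y : G) :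
    sigmaChar X (g * y) = c * sigmaChar X y := by
  rw [sigmaChar, sigmaChar, Finset.mul_sum]
  refine Finset.sum_congr rfl fun χ hχ => ?_
  rw [h χ (by simpa using hχ) y]
  ring

end Irreducible

namespace SupercharacterTheory

variable {G : Type*} [Group G] [Finite G] (S : SupercharacterTheory G)

/-! ### Superclasses and superclass functions -/

theorem superclass_eq_of_mem {K : Set G} (hK : K ∈ S.classes) {g : G} (hg : g ∈ K) :
    S.superclass g = K := by
  refine Set.Subset.antisymm (Set.sUnion_subset ?_) (Set.subset_sUnion_of_mem ⟨hK, hg⟩)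
  rintro L ⟨hL, hgL⟩
  exact ((S.classes_isPartition.2 g).unique ⟨hL, hgL⟩ ⟨hK, hg⟩).subset

theorem superclass_mem_classes (g : G) : S.superclass g ∈ S.classes := by
  obtain ⟨K, ⟨hK, hg⟩, -⟩ := S.classes_isPartition.2 g
  rwa [S.superclass_eq_of_mem hK hg]

theorem mem_superclass_self (g : G) : g ∈ S.superclass g := by
  obtain ⟨K, ⟨hK, hg⟩, -⟩ := S.classes_isPartition.2 g
  rwa [S.superclass_eq_of_mem hK hg]

theorem superclass_eq_superclass {g x : G} (hx : x ∈ S.superclass g) :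
    S.superclass x = S.superclass g :=
  S.superclass_eq_of_mem (S.superclass_mem_classes g) hx

theorem isSNormal_of_superclass_subset {N : Subgroup G}
    (h : ∀ g ∈ N, S.superclass g ⊆ N) : S.IsSNormal N := by
  refine ⟨S.superclass '' N, ?_, ?_⟩
  · rintro _ ⟨g, -, rfl⟩
    exact S.superclass_mem_classes g
  · refine Set.Subset.antisymm
      (fun g hg => ⟨_, ⟨g, hg, rfl⟩, S.mem_superclass_self g⟩) (Set.sUnion_subset ?_)
    rintro _ ⟨g, hg, rfl⟩
    exact h g hg

variable {S} in
theorem IsSNormal.superclass_subset {N : Subgroup G} (hN : S.IsSNormal N) {g : G} (hg : g ∈ N) :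
    S.superclass g ⊆ N := by
  obtain ⟨C, hC, hNC⟩ := hN
  rw [← SetLike.mem_coe, hNC] at hg
  obtain ⟨K, hK, hgK⟩ := hg
  rw [hNC, S.superclass_eq_of_mem (hC hK) hgK]
  exact Set.subset_sUnion_of_mem hK

theorem sigmaChar_eq_of_mem_superclass {X : Set (IrrChar G)} (hX : X ∈ S.charParts) {g x : G}
    (hx : x ∈ S.superclass g) : sigmaChar X x = sigmaChar X g :=
  S.sigma_const X hX _ (S.superclass_mem_classes g) x hx g (S.mem_superclass_self g)

theorem charPart_nonempty {X : Set (IrrChar G)} (hX : X ∈ S.charParts) : X.Nonempty :=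
  Setoid.nonempty_of_mem_partition S.charParts_isPartition hX

/-- Pairing a combination of supercharacters with `χ ∈ X` reads off the coefficient of `σ_X`. -/
theorem charPairing_sum_sigmaChar [Fintype S.charParts] (a : S.charParts → ℂ) (X : S.charParts)
    {χ : IrrChar G} (hχ : χ ∈ X.1) :
    charPairing χ (∑ Y, a Y • sigmaChar Y.1) = a X * χ.1 1 := by
  classical
  rw [map_sum, Finset.sum_eq_single X]
  · rw [map_smul, charPairing_sigmaChar, if_pos hχ, smul_eq_mul]
  · intro Y _ hYX
    rw [map_smul, charPairing_sigmaChar, if_neg, smul_zero]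
    exact fun hχY => hYX (Subtype.ext
      ((S.charParts_isPartition.2 χ).unique ⟨Y.2, hχY⟩ ⟨X.2, hχ⟩))
  · exact fun h => absurd (Finset.mem_univ X) h

/-- A function that is constant on superclasses is a combination of supercharacters: the
supercharacters are linearly independent superclass functions, and there are as many of them as
superclasses. -/
theorem exists_eq_sum_sigmaChar [Fintype S.charParts] {f : G → ℂ}
    (hf : ∀ g, ∀ x ∈ S.superclass g, f x = f g) :
    ∃ a : S.charParts → ℂ, f = ∑ X, a X • sigmaChar X.1 := by
  classical
  have := Fintype.ofFinite S.classes
  choose r hr using fun K : S.classes =>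
    Setoid.nonempty_of_mem_partition S.classes_isPartition K.2
  let c : G → S.classes := fun g => ⟨S.superclass g, S.superclass_mem_classes g⟩
  have hrc : ∀ g, S.superclass (r (c g)) = S.superclass g := fun g =>
    S.superclass_eq_superclass (hr (c g))
  -- Superclass functions are determined by their values at representatives of the superclasses.
  let T : (S.charParts → ℂ) →ₗ[ℂ] (S.classes → ℂ) :=
    (LinearMap.funLeft ℂ ℂ r).comp (Fintype.linearCombination ℂ fun X : S.charParts => sigmaChar X.1)
  have hT : ∀ a K, T a K = (∑ X, a X • sigmaChar X.1) (r K) := fun a K => by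
    simp [T, Fintype.linearCombination_apply, LinearMap.funLeft_apply]
  have hconst : ∀ (a : S.charParts → ℂ) (g : G),
      (∑ X, a X • sigmaChar X.1) g = T a (c g) := fun a g => by
    rw [hT]
    simp only [Finset.sum_apply, Pi.smul_apply]
    refine Finset.sum_congr rfl fun X _ => ?_
    rw [S.sigmaChar_eq_of_mem_superclass X.2 (hr (c g))]
  have hinj : Function.Injective T := by
    rw [← LinearMap.ker_eq_bot, LinearMap.ker_eq_bot']
    intro a ha
    have h0 : ∑ X, a X • sigmaChar X.1 = 0 := by
      ext g
      rw [hconst, ha]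
      rfl
    ext X
    obtain ⟨χ, hχ⟩ := S.charPart_nonempty X.2
    have := S.charPairing_sum_sigmaChar a X hχ
    rw [h0, map_zero] at this
    exact (mul_eq_zero.1 this.symm).resolve_right (IrrChar.apply_one_ne_zero χ)
  have hsurj : Function.Surjective T := by
    refine (LinearMap.injective_iff_surjective_of_finrank_eq_finrank ?_).1 hinj
    rw [Module.finrank_fintype_fun_eq_card, Module.finrank_fintype_fun_eq_card,
      Fintype.card_eq_nat_card, Fintype.card_eq_nat_card, Nat.card_coe_set_eq,
      Nat.card_coe_set_eq, S.ncard_eq]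
  obtain ⟨a, ha⟩ := hsurj fun K => f (r K)
  refine ⟨a, funext fun g => ?_⟩
  rw [hconst, ha]
  exact (hf g _ (hr (c g))).symm

theorem exists_indicator_eq_sum_sigmaChar [Fintype S.charParts] {U : Set G}
    (hU : ∀ g ∈ U, S.superclass g ⊆ U) :
    ∃ a : S.charParts → ℂ, U.indicator 1 = ∑ X, a X • sigmaChar X.1 := by
  classical
  refine S.exists_eq_sum_sigmaChar fun g x hx => ?_
  have hiff : x ∈ U ↔ g ∈ U := by
    refine ⟨fun h => hU x h ?_, fun h => hU g h hx⟩
    rw [S.superclass_eq_superclass hx]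
    exact S.mem_superclass_self g
  simp only [Set.indicator_apply, hiff, Pi.one_apply]

theorem exists_indicator_superclass_eq_sum_sigmaChar [Fintype S.charParts] (g : G) :
    ∃ a : S.charParts → ℂ, (S.superclass g).indicator 1 = ∑ X, a X • sigmaChar X.1 :=
  S.exists_indicator_eq_sum_sigmaChar fun _ hx => (S.superclass_eq_superclass hx).subset

/-- Superclasses are invariant under conjugation, because supercharacters are and the
supercharacters span the superclass functions. -/
theorem conj_mem_superclass (g h : G) : h * g * h⁻¹ ∈ S.superclass g := by
  have := Fintype.ofFinite S.charParts
  obtain ⟨a, ha⟩ := S.exists_indicator_superclass_eq_sum_sigmaChar g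
  have h1 := congrFun ha (h * g * h⁻¹)
  have h2 := congrFun ha g
  simp only [Finset.sum_apply, Pi.smul_apply, sigmaChar_conj] at h1 h2
  rw [← h2, Set.indicator_of_mem (S.mem_superclass_self g)] at h1
  by_contra hn
  rw [Set.indicator_of_notMem hn] at h1
  exact zero_ne_one h1

variable {S}

theorem IsSNormal.normal {N : Subgroup G} (hN : S.IsSNormal N) : N.Normal :=
  ⟨fun g hg h => hN.superclass_subset hg (S.conj_mem_superclass g h)⟩

/-! ### Supercharacters with an `S`-normal subgroup in their kernel -/

variable (S) in
/-- The parts of the partition of `Irr(G)` all of whose members have kernel containing `N`. -/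
def charPartsTrivialOn (N : Subgroup G) : Set (Set (IrrChar G)) :=
  {X | X ∈ S.charParts ∧ ∀ χ ∈ X, IrrChar.TrivialOn χ N}

theorem sigmaChar_mul_left_of_mem {N : Subgroup G} {X : Set (IrrChar G)}
    (hX : X ∈ S.charPartsTrivialOn N) {x : G} (hx : x ∈ N) (y : G) :
    sigmaChar X (x * y) = sigmaChar X y := by
  rw [sigmaChar_mul_left_eq (c := 1) fun χ hχ z => by rw [(hX.2 χ hχ).apply_mul_left hx, one_mul],
    one_mul]

/-- The supercharacters with the `S`-normal subgroup `N` in their kernel cut out `N`. The reason is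
that the indicator function of `N`, a multiple of the permutation character on `G ⧸ N`, is a
combination of them. -/
theorem IsSNormal.mem_of_forall_sigmaChar_eq {N : Subgroup G} (hN : S.IsSNormal N) {x : G}
    (hx : ∀ X ∈ S.charPartsTrivialOn N, sigmaChar X x = sigmaChar X 1) : x ∈ N := by
  classical
  have := Fintype.ofFinite S.charParts
  have := Fintype.ofFinite G
  have := Fintype.ofFinite N
  have := hN.normal
  obtain ⟨a, ha⟩ := S.exists_indicator_eq_sum_sigmaChar (U := N)
    fun g hg => hN.superclass_subset hg
  -- By orthogonality the coefficient of `σ_X` is, up to a nonzero factor, `∑_{x ∈ N} χ(x⁻¹)`.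
  have hmem : ∀ X : S.charParts, a X ≠ 0 → X.1 ∈ S.charPartsTrivialOn N := by
    refine fun X haX => ⟨X.2, fun χ hχ => IrrChar.trivialOn_of_finsum_ne_zero χ N fun h0 => ?_⟩
    have h := S.charPairing_sum_sigmaChar a X hχ
    rw [← ha, charPairing_apply] at h
    simp only [Set.indicator_apply, SetLike.mem_coe, Pi.one_apply, ite_mul, one_mul,
      zero_mul] at h
    rw [← Finset.sum_filter, Finset.sum_subtype (p := (· ∈ N)) _ (by simp),
      ← finsum_eq_sum_of_fintype, h0, mul_zero] at h
    exact mul_ne_zero haX (IrrChar.apply_one_ne_zero χ) h.symm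
  have h1 := congrFun ha x
  have h2 := congrFun ha 1
  have h12 : (∑ X, a X • sigmaChar X.1) x = (∑ X, a X • sigmaChar X.1) 1 := by
    simp only [Finset.sum_apply, Pi.smul_apply]
    refine Finset.sum_congr rfl fun X _ => ?_
    by_cases haX : a X = 0
    · rw [haX, zero_smul, zero_smul]
    · rw [hx X.1 (hmem X haX)]
  rw [h12, ← h2, Set.indicator_of_mem N.one_mem] at h1
  by_contra hn
  rw [Set.indicator_of_notMem hn] at h1
  exact zero_ne_one h1

/-- If the superclass of `g` lies in `gN` and the kernels of all members of the part `X` contain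
`N`, then `g` acts by one and the same scalar in all members of `X`. Indeed the scalar by which `g`
acts in `χ ∈ X` is determined by the pairing of `χ` with the indicator function of the superclass
of `g`, that is, up to the factor `χ(1)` by the coefficient of `σ_X` in it. -/
theorem exists_sigmaChar_mul_eq {N : Subgroup G} {g : G}
    (hg : ∀ x ∈ S.superclass g, g⁻¹ * x ∈ N) {X : Set (IrrChar G)}
    (hX : X ∈ S.charPartsTrivialOn N) :
    ∃ c : ℂ, ∀ y, sigmaChar X (g * y) = c * sigmaChar X y := by
  classical
  have := Fintype.ofFinite S.charParts
  have := Fintype.ofFinite G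
  obtain ⟨a, ha⟩ := S.exists_indicator_superclass_eq_sum_sigmaChar g
  let q : ℂ := (Nat.card G : ℂ)⁻¹ * ((Finset.univ.filter (· ∈ S.superclass g)).card : ℂ)
  have hq : q ≠ 0 := by
    refine mul_ne_zero (inv_ne_zero (Nat.cast_ne_zero.2 Nat.card_pos.ne')) (Nat.cast_ne_zero.2 ?_)
    exact Finset.card_ne_zero_of_mem (Finset.mem_filter.2 ⟨Finset.mem_univ g,
      S.mem_superclass_self g⟩)
  refine ⟨q / a ⟨X, hX.1⟩, sigmaChar_mul_left_eq fun χ hχ => ?_⟩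
  obtain ⟨c, hc⟩ := (hX.2 χ hχ).exists_apply_mul_eq (g := g) fun x => by
    simpa [mul_assoc] using hg _ (S.conj_mem_superclass g x⁻¹)
  have hc1 : χ.1 1 = c * χ.1 g⁻¹ := by rw [← hc, mul_inv_cancel]
  have hχg : χ.1 g⁻¹ ≠ 0 := right_ne_zero_of_mul (hc1 ▸ IrrChar.apply_one_ne_zero χ)
  have hpair := S.charPairing_sum_sigmaChar a ⟨X, hX.1⟩ hχ
  rw [← ha, charPairing_apply] at hpair
  -- On the superclass of `g` the function `x ↦ χ(x⁻¹)` is constant.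
  have hsum : ∑ x, (S.superclass g).indicator (1 : G → ℂ) x * χ.1 x⁻¹ =
      ((Finset.univ.filter (· ∈ S.superclass g)).card : ℂ) * χ.1 g⁻¹ := by
    rw [← nsmul_eq_mul, ← Finset.sum_const, Finset.sum_filter]
    refine Finset.sum_congr rfl fun x _ => ?_
    by_cases hx : x ∈ S.superclass g
    · rw [Set.indicator_of_mem hx, if_pos hx, Pi.one_apply, one_mul,
        ← (hX.2 χ hχ).apply_mul_left (N.inv_mem (hg x hx)) g⁻¹]
      simp
    · rw [Set.indicator_of_notMem hx, if_neg hx, zero_mul]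
  rw [hsum, hc1, ← mul_assoc, ← mul_assoc] at hpair
  have hqc : q = a ⟨X, hX.1⟩ * c := mul_right_cancel₀ hχg hpair
  -- So the scalar `c` does not depend on the choice of `χ` in `X`.
  have ha0 : a ⟨X, hX.1⟩ ≠ 0 := left_ne_zero_of_mul (hqc ▸ hq)
  intro y
  rw [hc, hqc, mul_div_cancel_left₀ _ ha0]

/-! ### The center modulo an `S`-normal subgroup -/

variable (S) in
/-- The preimage in `G` of `Z(S^{G/N})`, described by characters: the elements that act by a
single scalar in each supercharacter all of whose constituents are trivial on `N`. -/
def centerMod (N : Subgroup G) : Subgroup G where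
  carrier := {g | ∀ X ∈ S.charPartsTrivialOn N, ∃ c : ℂ,
    ∀ y, sigmaChar X (g * y) = c * sigmaChar X y}
  one_mem' X _ := ⟨1, fun y => by rw [one_mul, one_mul]⟩
  mul_mem' {g h} hg hh X hX := by
    obtain ⟨c, hc⟩ := hg X hX
    obtain ⟨d, hd⟩ := hh X hX
    exact ⟨c * d, fun y => by rw [mul_assoc, hc, hd, mul_assoc]⟩
  inv_mem' {g} hg X hX := by
    obtain ⟨c, hc⟩ := hg X hX
    have hc0 : c ≠ 0 := by
      have h := hc g⁻¹
      rw [mul_inv_cancel] at h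
      exact left_ne_zero_of_mul (h ▸ sigmaChar_one_ne_zero (S.charPart_nonempty hX.1))
    exact ⟨c⁻¹, fun y => by
      rw [eq_inv_mul_iff_mul_eq₀ hc0, ← hc, mul_inv_cancel_left]⟩

theorem le_centerMod (N : Subgroup G) : N ≤ S.centerMod N := fun x hx X hX =>
  ⟨1, fun y => by rw [sigmaChar_mul_left_of_mem hX hx, one_mul]⟩

theorem charPartsTrivialOn_anti {M N : Subgroup G} (h : M ≤ N) :
    S.charPartsTrivialOn N ⊆ S.charPartsTrivialOn M :=
  fun _ hX => ⟨hX.1, fun χ hχ => (hX.2 χ hχ).mono h⟩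

theorem centerMod_mono {M N : Subgroup G} (h : M ≤ N) : S.centerMod M ≤ S.centerMod N :=
  fun _ hg X hX => hg X (charPartsTrivialOn_anti h hX)

/-- With `IsSNormal.inv_mul_mem_of_mem_centerMod` this characterizes `centerMod` by superclasses:
`g` lies in it exactly when the superclass of `g` lies in `gN`. -/
theorem mem_centerMod_of_superclass {N : Subgroup G} {g : G}
    (hg : ∀ x ∈ S.superclass g, g⁻¹ * x ∈ N) : g ∈ S.centerMod N :=
  fun _ hX => exists_sigmaChar_mul_eq hg hX

theorem IsSNormal.inv_mul_mem_of_mem_centerMod {N : Subgroup G} (hN : S.IsSNormal N) {g : G}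
    (hg : g ∈ S.centerMod N) {x : G} (hx : x ∈ S.superclass g) : g⁻¹ * x ∈ N := by
  refine hN.mem_of_forall_sigmaChar_eq fun X hX => ?_
  obtain ⟨c, hc⟩ := hg X hX
  obtain ⟨d, hd⟩ := (S.centerMod N).inv_mem hg X hX
  rw [hd, S.sigmaChar_eq_of_mem_superclass hX.1 hx, ← hd, inv_mul_cancel]

theorem IsSNormal.centerMod {N : Subgroup G} (hN : S.IsSNormal N) :
    S.IsSNormal (S.centerMod N) := by
  refine S.isSNormal_of_superclass_subset fun g hg x hx => ?_
  rw [← mul_inv_cancel_left g x]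
  exact mul_mem hg (le_centerMod N (hN.inv_mul_mem_of_mem_centerMod hg hx))

/-- The class of `gN` is the union of the images of all superclasses that meet `gN`. This holds for
any subgroup `N`, whether or not these images form a partition. -/
theorem partOf_deflationClasses (N : Subgroup G) (g : G) :
    partOf (S.deflationClasses N) (g : G ⧸ N) =
      {z | ∃ n ∈ N, ∃ x ∈ S.superclass (g * n), (x : G ⧸ N) = z} := by
  ext z
  constructor
  · rintro ⟨_, ⟨⟨K, hK, rfl⟩, h, hhK, hh⟩, x, hx, rfl⟩
    refine ⟨g⁻¹ * h, QuotientGroup.eq.1 hh.symm, x, ?_, rfl⟩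
    rwa [mul_inv_cancel_left, S.superclass_eq_of_mem hK hhK]
  · rintro ⟨n, hn, x, hx, rfl⟩
    refine ⟨_, ⟨⟨_, S.superclass_mem_classes (g * n), rfl⟩, g * n, S.mem_superclass_self _, ?_⟩,
      x, hx, rfl⟩
    exact (QuotientGroup.mk_mul_of_mem g hn)

theorem mk_mem_deflationCenter_iff {N : Subgroup G} {g : G} :
    (g : G ⧸ N) ∈ S.deflationCenter N ↔ ∀ n ∈ N, ∀ x ∈ S.superclass (g * n), g⁻¹ * x ∈ N := by
  have hself : (g : G ⧸ N) ∈ partOf (S.deflationClasses N) (g : G ⧸ N) := by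
    rw [partOf_deflationClasses]
    exact ⟨1, N.one_mem, g, by rw [mul_one]; exact S.mem_superclass_self g, rfl⟩
  rw [deflationCenter, Set.mem_ofPred_eq, Set.ncard_eq_one]
  constructor
  · rintro ⟨z, hz⟩ n hn x hx
    have hx' : (x : G ⧸ N) ∈ partOf (S.deflationClasses N) (g : G ⧸ N) := by
      rw [partOf_deflationClasses]
      exact ⟨n, hn, x, hx, rfl⟩
    rw [hz, Set.mem_singleton_iff] at hself hx'
    exact QuotientGroup.eq.1 (hself.trans hx'.symm)
  · refine fun h => ⟨g, Set.Subset.antisymm ?_ (Set.singleton_subset_iff.2 hself)⟩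
    rw [partOf_deflationClasses]
    rintro _ ⟨n, hn, x, hx, rfl⟩
    exact (QuotientGroup.eq.2 (h n hn x hx)).symm

theorem mem_centerMod_of_mk_mem_deflationCenter {N : Subgroup G} {g : G}
    (hg : (g : G ⧸ N) ∈ S.deflationCenter N) : g ∈ S.centerMod N :=
  mem_centerMod_of_superclass fun x hx =>
    mk_mem_deflationCenter_iff.1 hg 1 N.one_mem x (by rwa [mul_one])

theorem IsSNormal.mk_mem_deflationCenter_iff {N : Subgroup G} (hN : S.IsSNormal N) {g : G} :
    (g : G ⧸ N) ∈ S.deflationCenter N ↔ g ∈ S.centerMod N := by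
  refine ⟨mem_centerMod_of_mk_mem_deflationCenter, fun hg => ?_⟩
  refine SupercharacterTheory.mk_mem_deflationCenter_iff.2 fun n hn x hx => ?_
  have := hN.inv_mul_mem_of_mem_centerMod (mul_mem hg (le_centerMod N hn)) hx
  simpa [mul_assoc] using mul_mem hn this

/-! ### The upper `S`-central series -/

theorem IsSNormal.closure_deflationCenter {N : Subgroup G} (hN : S.IsSNormal N) :
    Subgroup.closure ((QuotientGroup.mk : G → G ⧸ N) ⁻¹' S.deflationCenter N) =
      S.centerMod N := by
  have : (QuotientGroup.mk : G → G ⧸ N) ⁻¹' S.deflationCenter N = S.centerMod N :=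
    Set.ext fun g => hN.mk_mem_deflationCenter_iff
  rw [this, Subgroup.closure_eq]

variable (S)

theorem superclass_one : S.superclass 1 = {1} :=
  S.superclass_eq_of_mem S.singleton_one_mem rfl

theorem isSNormal_zeta (i : ℕ) : S.IsSNormal (S.zeta i) := by
  induction i with
  | zero =>
    refine S.isSNormal_of_superclass_subset fun g hg => ?_
    rw [zeta, Subgroup.mem_bot] at hg
    rw [hg, superclass_one, Set.singleton_subset_iff]
    exact one_mem _
  | succ i ih =>
    rw [zeta, ih.closure_deflationCenter]
    exact ih.centerMod

theorem zeta_succ (i : ℕ) : S.zeta (i + 1) = S.centerMod (S.zeta i) := by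
  rw [zeta, (S.isSNormal_zeta i).closure_deflationCenter]

theorem zeta_mono : Monotone S.zeta :=
  monotone_nat_of_le_succ fun i => by
    rw [zeta_succ]
    exact le_centerMod _

theorem zeta_succ_eq_top {i : ℕ} (h : S.comm ⊤ ≤ S.zeta i) : S.zeta (i + 1) = ⊤ := by
  rw [zeta_succ, eq_top_iff]
  exact fun g _ => mem_centerMod_of_superclass fun x hx =>
    h (Subgroup.subset_closure ⟨g, trivial, x, hx, rfl⟩)

/-- The upper `S`-central series is stationary from some positive index on. -/
theorem exists_zeta_eq : ∃ n, 0 < n ∧ ∀ m ≥ n, S.zeta m = S.zeta n := by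
  obtain ⟨n, hn⟩ := WellFoundedGT.monotone_chain_condition ⟨S.zeta, S.zeta_mono⟩
  have hn' : ∀ m, n ≤ m → S.zeta n = S.zeta m := hn
  exact ⟨n + 1, n.succ_pos, fun m hm => by rw [← hn' m (by omega), hn' (n + 1) (by omega)]⟩

variable {S}

theorem IsSNilpotent.exists_zeta_eq_top (h : S.IsSNilpotent) : ∃ c, 0 < c ∧ S.zeta c = ⊤ := by
  obtain ⟨r, N, h0, hr, -, hN⟩ := h
  -- The upper central series climbs at least as fast as the given series.
  have key : ∀ j ≤ r, N (r - j) ≤ S.zeta j := by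
    intro j
    induction j with
    | zero =>
      intro _
      rw [Nat.sub_zero, hr]
      exact bot_le
    | succ j ih =>
      intro hj g hg
      have hi : r - (j + 1) + 1 = r - j := by omega
      have hc := (hN (r - (j + 1)) (by omega)).2
      rw [hi] at hc
      rw [zeta_succ]
      exact centerMod_mono (ih (by omega))
        (mem_centerMod_of_mk_mem_deflationCenter (hc ⟨g, hg, rfl⟩))
  have htop : S.zeta r = ⊤ := by
    rw [eq_top_iff, ← h0, ← Nat.sub_self r]
    exact key r le_rfl
  exact ⟨r + 1, r.succ_pos, eq_top_iff.2 (htop ▸ S.zeta_mono r.le_succ)⟩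

theorem isSNilpotent_of_zeta_eq_top {n : ℕ} (h : S.zeta n = ⊤) : S.IsSNilpotent := by
  refine ⟨n, fun i => S.zeta (n - i), h, by simp [zeta], fun i _ => S.isSNormal_zeta _,
    fun i hi => ⟨S.zeta_mono (by omega), ?_⟩⟩
  rintro _ ⟨g, hg, rfl⟩
  rw [(S.isSNormal_zeta _).mk_mem_deflationCenter_iff, ← zeta_succ]
  have hi' : n - (i + 1) + 1 = n - i := by omega
  rwa [hi']

/-! ### The vanishing-off subgroup -/

/-- If `[G, S]` is not contained in the `S`-normal subgroup `N`, there is a supercharacter with `N`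
but not `[G, S]` in its kernel; it vanishes nowhere on the preimage of `Z(S^{G/N})`. -/
theorem IsSNormal.centerMod_le_vanishingOff {N : Subgroup G} (hN : S.IsSNormal N)
    (h : ¬ S.comm ⊤ ≤ N) : S.centerMod N ≤ S.vanishingOff := by
  obtain ⟨k, hk, hkN⟩ := SetLike.not_le_iff_exists.1 h
  obtain ⟨X, hX, hXk⟩ : ∃ X ∈ S.charPartsTrivialOn N, sigmaChar X k ≠ sigmaChar X 1 := by
    by_contra! hall
    exact hkN (hN.mem_of_forall_sigmaChar_eq hall)
  intro g hg
  refine Subgroup.subset_closure ⟨sigmaChar X, ⟨⟨X, hX.1, rfl⟩, fun hker => hXk (hker hk)⟩, ?_⟩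
  obtain ⟨c, hc⟩ := (S.centerMod N).inv_mem hg X hX
  have h1 := hc g
  rw [inv_mul_cancel] at h1
  exact right_ne_zero_of_mul (h1 ▸ sigmaChar_one_ne_zero (S.charPart_nonempty hX.1))

theorem zeta_succ_le_vanishingOff {m : ℕ} (h : ¬ S.comm ⊤ ≤ S.zeta m) :
    S.zeta (m + 1) ≤ S.vanishingOff := by
  rw [zeta_succ]
  exact (S.isSNormal_zeta m).centerMod_le_vanishingOff h

end SupercharacterTheory

theorem mainTheorem5 {G : Type*} [Group G] [Finite G] (S : SupercharacterTheory G) :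
    (∀ m : ℕ, ¬ S.comm ⊤ ≤ S.zeta m → S.zeta (m + 1) ≤ S.vanishingOff) ∧
    (S.IsSNilpotent → ∃ c : ℕ, S.IsSNilpotenceClass c ∧ S.zeta (c - 1) ≤ S.vanishingOff) ∧
    (¬ S.IsSNilpotent → ∃ H : Subgroup G, S.IsSHypercenter H ∧ H ≤ S.vanishingOff) := by
  classical
  refine ⟨fun m h => SupercharacterTheory.zeta_succ_le_vanishingOff h, fun hnil => ?_,
    fun hnil => ?_⟩
  · have hex := hnil.exists_zeta_eq_top
    have hleast : S.IsSNilpotenceClass (Nat.find hex) :=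
      ⟨Nat.find_spec hex, fun k hk => Nat.find_min' hex hk⟩
    refine ⟨Nat.find hex, hleast, ?_⟩
    generalize Nat.find hex = c at hleast
    obtain ⟨⟨hc, -⟩, hmin⟩ := hleast
    obtain rfl | ⟨d, rfl⟩ : c = 1 ∨ ∃ d, c = d + 2 := by
      obtain _ | _ | d := c
      · exact absurd hc (lt_irrefl 0)
      · exact Or.inl rfl
      · exact Or.inr ⟨d, rfl⟩
    -- For class one the claim is about `ζ_0 = 1`.
    · exact bot_le
    · refine SupercharacterTheory.zeta_succ_le_vanishingOff fun h => ?_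
      have := hmin ⟨d.succ_pos, S.zeta_succ_eq_top h⟩
      omega
  · obtain ⟨n, hn, hstat⟩ := S.exists_zeta_eq
    refine ⟨S.zeta n, ⟨n, hn, rfl, hstat⟩, ?_⟩
    rw [← hstat (n + 1) n.le_succ]
    exact SupercharacterTheory.zeta_succ_le_vanishingOff fun h =>
      hnil (SupercharacterTheory.isSNilpotent_of_zeta_eq_top (S.zeta_succ_eq_top h))
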